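/- Let $f$ be a (jointly measurable) random function $\mathbb{R}\to\mathbb{R}$, let $g\sim\mathcal N(0,1)$ be independent of $f$, and suppose that $\mathbb{E}[f(g)^4]<\infty$ and $\mu:=\mathbb{E}[f(g)g]\neq 0$. Put $\xi:=\sqrt{\mathbb{E}[f(g)^2]}$, $\rho^2:=\mathrm{Var}[f(g)g]$ and $\theta^4:=\mathrm{Var}[f(g)^2]$. Let $m,n,k\ge 1$, $r>0$, $B_2^k(r)=\{z\in\mathbb{R}^k:\|z\|_2\le r\}$, let $G:B_2^k(r)\to\mathbb{R}^n$ be $L$-Lipschitz with range $\mathcal R(G)$, and let $x\in\mathbb{R}^n$ satisfy $\|x\|_2=1$ and $\mu x\in\mathcal R(G)$. Let $a_1,\dots,a_m$ be i.i.d. $\mathcal N(0,I_n)$ vectors, let $f_1,\dots,f_m$ be i.i.d. realizations of $f$, independent of $(a_1,\dots,a_m)$, let $y_i=f_i(\langle a_i,x\rangle)$, $y=(y_1,\dots,y_m)^T$, let $A\in\mathbb{R}^{m\times n}$ be the matrix with rows $a_i^T$, and let $\hat x$ be a point of $\mathcal R(G)$ closest to $\frac1m A^Ty$ in $\|\cdot\|_2$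 (with an arbitrary choice if there are several). For all constants $c_1,c_2>0$ there are constants $c,C>0$, depending only on $c_1$ and $c_2$ (and not on $m,n,k,r,L,\delta,f,G,x$), such that the following holds. If $\delta>0$ satisfies $$Lr\ge c_1\,\delta n\qquad\text{and}\qquad \delta\le c_2\,\xi\sqrt{\frac{k\log\frac{Lr}{\delta}}{m}},$$ then, with probability at least $$1-e^{-c\,k\log\frac{Lr}{\delta}}-\frac{\theta^4}{m\xi^4}-\frac{\rho^2}{\xi^2k\log\frac{Lr}{\delta}},$$ we have $$\|\hat x-\mu x\|_2\le C\,\xi\sqrt{\frac{k\log\frac{Lr}{\delta}}{m}}.$$ (If $Lr\le\delta$, the second condition on $\delta$ is regarded as not satisfied.) -/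

import Mathlib

open MeasureTheory ProbabilityTheory
open scoped NNReal

noncomputable section

/-- `ℝⁿ` with its Euclidean norm. -/
abbrev Vec (n : ℕ) : Type := EuclideanSpace ℝ (Fin n)

/-- The closed ball `B₂ᵏ(r)` of radius `r` around the origin of `ℝᵏ`. -/
abbrev latentBall (k : ℕ) (r : ℝ) : Set (Vec k) := Metric.closedBall 0 r

section Parameters

/- A random function is `f : Θ → ℝ → ℝ` together with a probability measure `ν` on the space `Θ` of
random seeds: a realization is the function `f s` for a seed `s` of law `ν`. Below `g` is standard
normal and independent of the seed, so that the pair (seed, `g`) has law `ν ⊗ N(0,1)`. -/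

variable {Θ : Type*} [MeasurableSpace Θ]

/-- The joint law of the seed of `f` and of an independent standard normal `g`. -/
def seedGaussian (ν : Measure Θ) : Measure (Θ × ℝ) := ν.prod (gaussianReal 0 1)

/-- `E[f(g)⁴] < ∞`. -/
def FiniteFourthMoment (f : Θ → ℝ → ℝ) (ν : Measure Θ) : Prop :=
  Integrable (fun p : Θ × ℝ => f p.1 p.2 ^ 4) (seedGaussian ν)

/-- `μ = E[f(g) g]`. -/
def simMu (f : Θ → ℝ → ℝ) (ν : Measure Θ) : ℝ :=
  ∫ p, f p.1 p.2 * p.2 ∂(seedGaussian ν)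

/-- `ξ ≥ 0` with `ξ² = E[f(g)²]`. -/
def simXi (f : Θ → ℝ → ℝ) (ν : Measure Θ) : ℝ :=
  Real.sqrt (∫ p, f p.1 p.2 ^ 2 ∂(seedGaussian ν))

/-- `ρ² = Var[f(g) g]`. -/
def simRhoSq (f : Θ → ℝ → ℝ) (ν : Measure Θ) : ℝ :=
  variance (fun p : Θ × ℝ => f p.1 p.2 * p.2) (seedGaussian ν)

/-- `θ⁴ = Var[f(g)²]`. -/
def simThetaFourth (f : Θ → ℝ → ℝ) (ν : Measure Θ) : ℝ :=
  variance (fun p : Θ × ℝ => f p.1 p.2 ^ 2) (seedGaussian ν)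

end Parameters

/-- The randomness of the single index model with `m` measurements in dimension `n`: `a i` are
i.i.d. standard Gaussian vectors, `s i` are i.i.d. seeds of law `ν` (so that the functions
`f (s i)` are i.i.d. realizations of the random function), and the seeds are independent of the
measurement vectors. -/
structure IsSIMSample {Ω Θ : Type*} [MeasurableSpace Ω] [MeasurableSpace Θ] {m n : ℕ}
    (P : Measure Ω) (ν : Measure Θ) (a : Fin m → Ω → Vec n) (s : Fin m → Ω → Θ) : Prop where
  law_a : ∀ i, HasLaw (a i) (stdGaussian (Vec n)) P
  law_s : ∀ i, HasLaw (s i) ν P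
  indep_a_s : ∀ i, IndepFun (a i) (s i) P
  indep_pairs : iIndepFun (fun i ω => (a i ω, s i ω)) P

/-- The measurement matrix `A` with rows `a₁ᵀ, …, aₘᵀ`. -/
def measMatrix {m n : ℕ} (a : Fin m → Vec n) : Matrix (Fin m) (Fin n) ℝ :=
  Matrix.of fun i j => a i j

/-- The observations `y i = fᵢ (⟨aᵢ, x⟩)`, where `fᵢ = f (s i)`. -/
def simObs {Θ : Type*} {m n : ℕ} (f : Θ → ℝ → ℝ) (x : Vec n) (a : Fin m → Vec n)
    (s : Fin m → Θ) : Fin m → ℝ :=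
  fun i => f (s i) (inner ℝ (a i) x)

/-- The vector `(1/m) Aᵀ y`. -/
def backProj {m n : ℕ} (A : Matrix (Fin m) (Fin n) ℝ) (y : Fin m → ℝ) : Vec n :=
  WithLp.toLp 2 ((1 / (m : ℝ)) • A.transpose.mulVec y)

/-- `w` is a projection of `v` onto `S`: it lies in `S` and minimizes the distance to `v`. -/
def IsProjOn {n : ℕ} (S : Set (Vec n)) (v w : Vec n) : Prop :=
  w ∈ S ∧ ∀ w' ∈ S, ‖w - v‖ ≤ ‖w' - v‖

end

/-!
Write `b = (1/m) Aᵀ y`, `ℓ = k log (L r / δ)` and `T = ξ √(ℓ / m)`. Since `μ x` is a competitor in the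
projection of `b`, the error `h = x̂ - μ x` satisfies `‖h‖² ≤ 2 ⟪b - μ x, h⟫`, so it suffices to
control the deviation `b - μ x` on the range of `G`.

Along `x`, the deviation is the centered empirical mean of `f(g) g`, and Chebyshev's inequality makes
it at most `T` (`IsSIMSample.measure_abs_mean_sub_ge_le`). Orthogonally to `x`, the measurement
vectors are independent of the observations, so the deviation is a Gaussian vector multiplied by
`‖y‖ / m`, and `‖y‖² ≤ 2 m ξ²` by Chebyshev's inequality for `f(g)²`. Conditioning on `y` is avoided
by means of the exponential variable `exp (c Z - c² ‖y‖² ‖v‖² / 2)` with `Z = ∑ i, y i ⟪a i, v⟫`,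
which has mean one (`IsSIMSample.measure_sum_mul_inner_gt_le`).

This Gaussian part is bounded by a union bound over a net of the range of `G` of resolution `δ / √n`
and over the coordinate axes. The axes bound the norm of the Gaussian part by `O(√n T)`, so that the
approximation by the net costs only `O(T δ) = O(T²)`. The hypothesis `c₁ δ n ≤ L r` makes `n`
polynomial in `L r / δ`, hence the logarithm of the size of the net is of order `ℓ`, provided that
`L r / δ` exceeds a constant. The resulting quadratic inequality for `‖h‖` gives `‖h‖ = O(T)`
(`norm_sub_le_of_norm_sub_le`). If `L r / δ` is below the constant, the diameter `2 L r` of the range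
is already `O(δ) = O(T)`.
-/

/-! ### Covering numbers of balls -/

lemma card_le_of_norm_le_of_separated {E : Type*} [NormedAddCommGroup E] [NormedSpace ℝ E]
    [FiniteDimensional ℝ E] {r ε : ℝ} (hr : 0 ≤ r) (hε : 0 < ε) (s : Finset E)
    (hs : ∀ c ∈ s, ‖c‖ ≤ r) (h : ∀ c ∈ s, ∀ d ∈ s, c ≠ d → ε < dist c d) :
    (s.card : ℝ) ≤ (1 + 2 * r / ε) ^ Module.finrank ℝ E := by
  borelize E
  let μ : Measure E := Measure.addHaar
  have hε2 : 0 < ε / 2 := by positivity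
  have hR : 0 < r + ε / 2 := by positivity
  have hdisj : Set.Pairwise (s : Set E)
      (Function.onFun Disjoint fun c => Metric.ball (c : E) (ε / 2)) := by
    intro c hc d hd hcd
    apply Metric.ball_disjoint_ball
    rw [add_halves]
    exact (h c hc d hd hcd).le
  have hsub : (⋃ c ∈ s, Metric.ball (c : E) (ε / 2)) ⊆ Metric.ball 0 (r + ε / 2) := by
    refine Set.iUnion₂_subset fun c hc => Metric.ball_subset_ball' ?_
    rw [dist_zero_right]
    linarith [hs c hc]
  have hvol : (s.card : ENNReal) * ENNReal.ofReal ((ε / 2) ^ Module.finrank ℝ E)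
        * μ (Metric.ball 0 1)
      ≤ ENNReal.ofReal ((r + ε / 2) ^ Module.finrank ℝ E) * μ (Metric.ball 0 1) := by
    have := measure_mono (μ := μ) hsub
    rw [measure_biUnion_finset hdisj fun c _ => Metric.isOpen_ball.measurableSet] at this
    simpa only [μ.addHaar_ball_of_pos _ hε2, μ.addHaar_ball_of_pos _ hR, Finset.sum_const,
      nsmul_eq_mul, mul_assoc] using this
  have hcard := (ENNReal.mul_le_mul_iff_left (Metric.measure_ball_pos μ _ zero_lt_one).ne'
    measure_ball_lt_top.ne).1 hvol
  have hreal := ENNReal.toReal_le_of_le_ofReal (pow_nonneg hR.le _) hcard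
  rw [ENNReal.toReal_mul, ENNReal.toReal_natCast, ENNReal.toReal_ofReal (by positivity),
    ← le_div_iff₀ (by positivity), ← div_pow] at hreal
  rwa [show 1 + 2 * r / ε = (r + ε / 2) / (ε / 2) by field_simp; ring]

/-- The volumetric bound on covering numbers of a ball: a maximal `ε`-separated subset is an
`ε`-net. -/
lemma exists_finset_net_closedBall {E : Type*} [NormedAddCommGroup E] [NormedSpace ℝ E]
    [FiniteDimensional ℝ E] {r ε : ℝ} (hr : 0 ≤ r) (hε : 0 < ε) :
    ∃ s : Finset E, (∀ c ∈ s, c ∈ Metric.closedBall (0 : E) r) ∧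
      (∀ z ∈ Metric.closedBall (0 : E) r, ∃ c ∈ s, dist z c ≤ ε) ∧
      (s.card : ℝ) ≤ (1 + 2 * r / ε) ^ Module.finrank ℝ E := by
  classical
  let S : Set ℕ := {N | ∃ s : Finset E, s.card = N ∧ (∀ c ∈ s, ‖c‖ ≤ r) ∧
    ∀ c ∈ s, ∀ d ∈ s, c ≠ d → ε < dist c d}
  have hne : S.Nonempty := ⟨0, ∅, by simp⟩
  have hbdd : BddAbove S := by
    refine ⟨⌊(1 + 2 * r / ε) ^ Module.finrank ℝ E⌋₊, ?_⟩
    rintro _ ⟨s, rfl, h₁, h₂⟩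
    exact Nat.le_floor (card_le_of_norm_le_of_separated hr hε s h₁ h₂)
  obtain ⟨s, hcard, h₁, h₂⟩ := Nat.sSup_mem hne hbdd
  refine ⟨s, fun c hc => by simpa using h₁ c hc, fun z hz => ?_,
    card_le_of_norm_le_of_separated hr hε s h₁ h₂⟩
  by_contra! hfar
  have hzs : z ∉ s := fun hz' => by
    have := hfar z hz'
    rw [dist_self] at this
    linarith
  have hmem : (insert z s).card ∈ S := by
    refine ⟨insert z s, rfl, ?_, ?_⟩
    · intro c hc
      rcases Finset.mem_insert.1 hc with rfl | hc
      · simpa using hz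
      · exact h₁ c hc
    · intro c hc d hd hcd
      rcases Finset.mem_insert.1 hc with rfl | hc' <;> rcases Finset.mem_insert.1 hd with rfl | hd'
      · exact absurd rfl hcd
      · exact hfar d hd'
      · rw [dist_comm]; exact hfar c hc'
      · exact h₂ c hc' d hd' hcd
  have := le_csSup hbdd hmem
  rw [Finset.card_insert_of_notMem hzs, ← hcard] at this
  omega

/-! ### Exponential moments of Gaussian vectors -/

lemma lintegral_prod_eq_prod_lintegral_of_iIndepFun {Ω ι : Type*} [MeasurableSpace Ω]
    {μ : Measure Ω} (s : Finset ι) {X : ι → Ω → ENNReal} (hX : iIndepFun X μ)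
    (hm : ∀ i, AEMeasurable (X i) μ) :
    ∫⁻ ω, ∏ i ∈ s, X i ω ∂μ = ∏ i ∈ s, ∫⁻ ω, X i ω ∂μ := by
  have hae : ∀ᵐ ω ∂μ, ∀ i ∈ s, X i ω = (hm i).mk (X i) ω :=
    (Finset.eventually_all s).2 fun i _ => (hm i).ae_eq_mk
  rw [lintegral_congr_ae (hae.mono fun ω h => Finset.prod_congr rfl h),
    lintegral_prod_eq_prod_lintegral_of_indepFun s _ (hX.congr fun i => (hm i).ae_eq_mk)
      fun i => (hm i).measurable_mk]
  exact Finset.prod_congr rfl fun i _ => (lintegral_congr_ae (hm i).ae_eq_mk).symm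

lemma covariance_inner_stdGaussian {n : ℕ} (u v : Vec n) :
    cov[fun a : Vec n => inner ℝ u a, fun a => inner ℝ v a; stdGaussian (Vec n)]
      = inner ℝ u v := by
  rw [← covarianceBilin_apply_eq_cov IsGaussian.memLp_two_id, covarianceBilin_stdGaussian]
  rfl

lemma hasLaw_inner_stdGaussian {n : ℕ} (u : Vec n) :
    HasLaw (fun a : Vec n => inner ℝ u a) (gaussianReal 0 (‖u‖₊ ^ 2)) (stdGaussian (Vec n)) where
  aemeasurable := by fun_prop
  map_eq := by
    have h : (fun a : Vec n => inner ℝ u a) = innerSL ℝ u := by ext; simp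
    have hv := covariance_inner_stdGaussian u u
    rw [covariance_self (by fun_prop), h] at hv
    rw [h, IsGaussian.map_eq_gaussianReal, hv, integral_strongDual_stdGaussian]
    congr 1
    rw [real_inner_self_eq_norm_sq]
    ext
    simp

/-- Coordinates of a standard Gaussian vector along orthogonal directions are independent. -/
lemma hasLaw_inner_prodMk_stdGaussian {n : ℕ} {u v : Vec n} (huv : inner ℝ u v = 0) :
    HasLaw (fun a : Vec n => ((inner ℝ u a, inner ℝ v a) : ℝ × ℝ))
      ((gaussianReal 0 (‖u‖₊ ^ 2)).prod (gaussianReal 0 (‖v‖₊ ^ 2))) (stdGaussian (Vec n)) := by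
  refine (indepFun_iff_hasLaw_prodMk_prod (hasLaw_inner_stdGaussian u)
    (hasLaw_inner_stdGaussian v)).1 (HasGaussianLaw.indepFun_of_covariance_eq_zero ?_ ?_)
  · exact (IsGaussian.hasGaussianLaw_id (μ := stdGaussian (Vec n))).map_fun
      ((innerSL ℝ u).prod (innerSL ℝ v))
  · rw [covariance_inner_stdGaussian, huv]

lemma lintegral_exp_gaussianReal (σ : ℝ≥0) (c : ℝ) :
    ∫⁻ t, ENNReal.ofReal (Real.exp (c * t - (c * σ) ^ 2 / 2)) ∂(gaussianReal 0 (σ ^ 2)) = 1 := by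
  simp_rw [sub_eq_add_neg, Real.exp_add]
  rw [← ofReal_integral_eq_lintegral_ofReal
    ((integrable_exp_mul_gaussianReal c).mul_const _) (.of_forall fun t => by positivity),
    integral_mul_const]
  have h := mgf_gaussianReal (p := gaussianReal 0 (σ ^ 2)) (X := id) Measure.map_id c
  simp only [mgf, id] at h
  rw [h, ← Real.exp_add]
  simp only [NNReal.coe_pow, zero_mul]
  rw [show (0 : ℝ) + σ ^ 2 * c ^ 2 / 2 + -((c * σ) ^ 2 / 2) = 0 by ring]
  simp

/-- Conditionally on `φ s ⟨x, a⟩`, which is independent of `⟨v, a⟩`, the variable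
`φ s ⟨x, a⟩ * ⟨v, a⟩` is centered Gaussian with standard deviation `|φ s ⟨x, a⟩| * ‖v‖`. -/
lemma lintegral_exp_mul_inner_stdGaussian {Θ : Type*} [MeasurableSpace Θ] {n : ℕ}
    (ν : Measure Θ) [IsProbabilityMeasure ν] {φ : Θ → ℝ → ℝ}
    (hφ : Measurable (Function.uncurry φ)) {x v : Vec n} (hxv : inner ℝ x v = 0) (c : ℝ) :
    ∫⁻ p : Vec n × Θ, ENNReal.ofReal (Real.exp (c * (φ p.2 (inner ℝ x p.1) * inner ℝ v p.1)
        - c ^ 2 * φ p.2 (inner ℝ x p.1) ^ 2 * ‖v‖ ^ 2 / 2)) ∂((stdGaussian (Vec n)).prod ν)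
      = 1 := by
  have hm : Measurable fun p : Vec n × Θ => φ p.2 (inner ℝ x p.1) :=
    hφ.comp (measurable_snd.prodMk (by fun_prop))
  rw [lintegral_prod_symm _ (by fun_prop)]
  have key : ∀ s : Θ, ∫⁻ a : Vec n, ENNReal.ofReal (Real.exp (c * (φ s (inner ℝ x a)
      * inner ℝ v a) - c ^ 2 * φ s (inner ℝ x a) ^ 2 * ‖v‖ ^ 2 / 2)) ∂(stdGaussian (Vec n))
      = 1 := by
    intro s
    have hs : Measurable (φ s) := hφ.comp measurable_prodMk_left
    have hlaw := (hasLaw_inner_prodMk_stdGaussian hxv).lintegral_comp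
      (f := fun q : ℝ × ℝ => ENNReal.ofReal (Real.exp (c * (φ s q.1 * q.2)
        - c ^ 2 * φ s q.1 ^ 2 * ‖v‖ ^ 2 / 2))) (by fun_prop)
    rw [hlaw, lintegral_prod _ (by fun_prop)]
    have hin : ∀ g : ℝ, ∫⁻ t, ENNReal.ofReal (Real.exp (c * (φ s g * t)
        - c ^ 2 * φ s g ^ 2 * ‖v‖ ^ 2 / 2)) ∂(gaussianReal 0 (‖v‖₊ ^ 2)) = 1 := by
      intro g
      rw [← lintegral_exp_gaussianReal ‖v‖₊ (c * φ s g)]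
      congr with t
      rw [coe_nnnorm]
      congr 2
      ring
    simp only [hin, lintegral_const, measure_univ, mul_one]
  simp only [key, lintegral_const, measure_univ, mul_one]

/-! ### Concentration over a sample of the single index model -/

section Sample

variable {Ω Θ : Type*} [MeasurableSpace Ω] [MeasurableSpace Θ] {m n : ℕ}
  {P : Measure Ω} [IsProbabilityMeasure P] {ν : Measure Θ}
  {a : Fin m → Ω → Vec n} {s : Fin m → Ω → Θ}

lemma IsSIMSample.hasLaw_prodMk (h : IsSIMSample P ν a s) (i : Fin m) :
    HasLaw (fun ω => (a i ω, s i ω)) ((stdGaussian (Vec n)).prod ν) P :=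
  (indepFun_iff_hasLaw_prodMk_prod (h.law_a i) (h.law_s i)).1 (h.indep_a_s i)

lemma IsSIMSample.hasLaw_seedGaussian (h : IsSIMSample P ν a s)
    {x : Vec n} (hx : ‖x‖ = 1) (i : Fin m) :
    HasLaw (fun ω => (s i ω, (inner ℝ (a i ω) x : ℝ))) (seedGaussian ν) P := by
  have hg : HasLaw (fun ω => (inner ℝ (a i ω) x : ℝ)) (gaussianReal 0 1) P := by
    have := (hasLaw_inner_stdGaussian x).fun_comp (h.law_a i)
    have hx' : ‖x‖₊ = 1 := by ext; simpa using hx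
    simpa [hx', real_inner_comm] using this
  exact (indepFun_iff_hasLaw_prodMk_prod (h.law_s i) hg).1
    ((h.indep_a_s i).symm.comp measurable_id
      (by fun_prop : Measurable fun b : Vec n => (inner ℝ b x : ℝ)))

/-- Chebyshev's inequality for empirical means over the sample. -/
lemma IsSIMSample.measure_abs_mean_sub_ge_le (h : IsSIMSample P ν a s)
    (hm : 0 < m) {x : Vec n} (hx : ‖x‖ = 1) {φ : Θ × ℝ → ℝ} (hφ : Measurable φ)
    (hφ2 : MemLp φ 2 (seedGaussian ν)) {t : ℝ} (ht : 0 < t) :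
    P {ω | t ≤ |(1 / (m : ℝ)) * ∑ i, φ (s i ω, inner ℝ (a i ω) x) - ∫ p, φ p ∂(seedGaussian ν)|}
      ≤ ENNReal.ofReal (variance φ (seedGaussian ν) / (m * t ^ 2)) := by
  have hm' : (0 : ℝ) < m := by exact_mod_cast hm
  let W : Fin m → Ω → ℝ := fun i ω => φ (s i ω, inner ℝ (a i ω) x)
  have hlaw := fun i => h.hasLaw_seedGaussian hx i
  have hW : ∀ i, MemLp (W i) 2 P := fun i => by
    have := hφ2
    rw [← (hlaw i).map_eq] at this
    exact this.comp_of_map (hlaw i).aemeasurable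
  have hint : ∀ i, ∫ ω, W i ω ∂P = ∫ p, φ p ∂(seedGaussian ν) := fun i =>
    (hlaw i).integral_comp hφ.aestronglyMeasurable
  have hvar : ∀ i, variance (W i) P = variance φ (seedGaussian ν) := fun i => by
    rw [← (hlaw i).map_eq, variance_map hφ.aemeasurable (hlaw i).aemeasurable]
    rfl
  have hind : Set.Pairwise (↑(Finset.univ : Finset (Fin m)))
      fun i j => IndepFun (W i) (W j) P := fun i _ j _ hij =>
    (h.indep_pairs.indepFun hij).comp
      (φ := fun p : Vec n × Θ => φ (p.2, inner ℝ p.1 x))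
      (ψ := fun p : Vec n × Θ => φ (p.2, inner ℝ p.1 x)) (by fun_prop) (by fun_prop)
  have hmean : ∫ ω, (1 / (m : ℝ)) * (∑ i, W i) ω ∂P = ∫ p, φ p ∂(seedGaussian ν) := by
    simp only [Finset.sum_apply]
    rw [integral_const_mul, integral_finsetSum _ fun i _ => (hW i).integrable (by norm_num)]
    simp only [hint, Finset.sum_const, Finset.card_univ, Fintype.card_fin, nsmul_eq_mul]
    field_simp
  have hcheb := meas_ge_le_variance_div_sq (μ := P)
    ((memLp_finsetSum' Finset.univ fun i _ => hW i).const_mul (1 / (m : ℝ))) ht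
  rw [hmean, variance_const_mul, IndepFun.variance_sum (fun i _ => hW i) hind] at hcheb
  simp only [hvar, Finset.sum_const, Finset.card_univ, Fintype.card_fin, nsmul_eq_mul,
    Finset.sum_apply] at hcheb
  refine hcheb.trans_eq ?_
  congr 1
  field_simp

/-- A self-normalized Gaussian tail bound. Although the coefficients `φ (s i) ⟨a i, x⟩` are random,
they are independent of the Gaussian variables `⟨a i, v⟩`, so that
`exp (c * ∑ i, φᵢ ⟨a i, v⟩ - c ^ 2 / 2 * (∑ i, φᵢ ^ 2) * ‖v‖ ^ 2)` has mean one. -/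
lemma IsSIMSample.measure_sum_mul_inner_gt_le [IsProbabilityMeasure ν]
    (h : IsSIMSample P ν a s)
    {φ : Θ → ℝ → ℝ} (hφ : Measurable (Function.uncurry φ)) {x v : Vec n}
    (hxv : inner ℝ x v = 0) {B t : ℝ} (hB : 0 < B) (ht : 0 ≤ t) :
    P {ω | ∑ i, φ (s i ω) (inner ℝ (a i ω) x) ^ 2 ≤ B ∧
        t * ‖v‖ < ∑ i, φ (s i ω) (inner ℝ (a i ω) x) * inner ℝ (a i ω) v}
      ≤ ENNReal.ofReal (Real.exp (-(t ^ 2 / (2 * B)))) := by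
  rcases eq_or_ne v 0 with rfl | hv
  · simp
  have hv' : 0 < ‖v‖ := norm_pos_iff.2 hv
  let c : ℝ := t / (B * ‖v‖)
  let F : Vec n × Θ → ENNReal := fun p => ENNReal.ofReal (Real.exp
    (c * (φ p.2 (inner ℝ x p.1) * inner ℝ v p.1)
      - c ^ 2 * φ p.2 (inner ℝ x p.1) ^ 2 * ‖v‖ ^ 2 / 2))
  have hφm : Measurable fun p : Vec n × Θ => φ p.2 (inner ℝ x p.1) :=
    hφ.comp (measurable_snd.prodMk (by fun_prop))
  have hF : Measurable F := by fun_prop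
  have hFa : ∀ i, AEMeasurable (fun ω => F (a i ω, s i ω)) P := fun i =>
    hF.comp_aemeasurable (h.hasLaw_prodMk i).aemeasurable
  have hone : ∫⁻ ω, ∏ i, F (a i ω, s i ω) ∂P = 1 := by
    have hind : iIndepFun (fun i ω => F (a i ω, s i ω)) P :=
      h.indep_pairs.comp (fun _ => F) fun _ => hF
    rw [lintegral_prod_eq_prod_lintegral_of_iIndepFun _ hind hFa]
    refine Finset.prod_eq_one fun i _ => ?_
    exact ((h.hasLaw_prodMk i).lintegral_comp hF.aemeasurable).trans
      (lintegral_exp_mul_inner_stdGaussian ν hφ hxv c)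
  have hprod : ∀ ω, ∏ i, F (a i ω, s i ω) = ENNReal.ofReal (Real.exp
      (c * ∑ i, φ (s i ω) (inner ℝ (a i ω) x) * inner ℝ (a i ω) v
        - c ^ 2 * (∑ i, φ (s i ω) (inner ℝ (a i ω) x) ^ 2) * ‖v‖ ^ 2 / 2)) := by
    intro ω
    simp only [F]
    rw [← ENNReal.ofReal_prod_of_nonneg fun i _ => (Real.exp_pos _).le, ← Real.exp_sum]
    congr 2
    rw [Finset.sum_sub_distrib, Finset.mul_sum, Finset.mul_sum, Finset.sum_mul, Finset.sum_div]
    simp only [real_inner_comm]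
  have hmarkov := mul_meas_ge_le_lintegral₀
    (Finset.aemeasurable_fun_prod Finset.univ fun i _ => hFa i)
    (ENNReal.ofReal (Real.exp (t ^ 2 / (2 * B))))
  rw [hone, mul_comm] at hmarkov
  have hpos : (0 : ℝ) < Real.exp (t ^ 2 / (2 * B)) := Real.exp_pos _
  rw [← ENNReal.le_div_iff_mul_le (Or.inl (ENNReal.ofReal_pos.2 hpos).ne')
    (Or.inl ENNReal.ofReal_ne_top), one_div, ← ENNReal.ofReal_inv_of_pos hpos,
    ← Real.exp_neg] at hmarkov
  refine (measure_mono fun ω hω => ?_).trans hmarkov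
  obtain ⟨h₁, h₂⟩ := hω
  simp only [Set.mem_ofPred_eq, hprod]
  refine ENNReal.ofReal_le_ofReal (Real.exp_le_exp.2 ?_)
  have hc : 0 ≤ c := by positivity
  have e₁ : c * (t * ‖v‖) = t ^ 2 / B := by simp only [c]; field_simp
  have e₂ : c ^ 2 * B * ‖v‖ ^ 2 / 2 = t ^ 2 / (2 * B) := by simp only [c]; field_simp
  have i₁ := mul_le_mul_of_nonneg_left h₂.le hc
  have i₂ : c ^ 2 * (∑ i, φ (s i ω) (inner ℝ (a i ω) x) ^ 2) * ‖v‖ ^ 2 / 2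
      ≤ c ^ 2 * B * ‖v‖ ^ 2 / 2 := by gcongr
  have e₃ : t ^ 2 / B = t ^ 2 / (2 * B) + t ^ 2 / (2 * B) := by field_simp; norm_num
  linarith

lemma IsSIMSample.measure_abs_sum_mul_inner_gt_le [IsProbabilityMeasure ν]
    (h : IsSIMSample P ν a s) {φ : Θ → ℝ → ℝ} (hφ : Measurable (Function.uncurry φ))
    {x v : Vec n} (hxv : inner ℝ x v = 0) {B t : ℝ} (hB : 0 < B) (ht : 0 ≤ t) :
    P {ω | ∑ i, φ (s i ω) (inner ℝ (a i ω) x) ^ 2 ≤ B ∧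
        t * ‖v‖ < |∑ i, φ (s i ω) (inner ℝ (a i ω) x) * inner ℝ (a i ω) v|}
      ≤ ENNReal.ofReal (2 * Real.exp (-(t ^ 2 / (2 * B)))) := by
  have h₁ := h.measure_sum_mul_inner_gt_le hφ hxv hB ht
  have h₂ := h.measure_sum_mul_inner_gt_le hφ (v := -v) (by simpa using hxv) hB ht
  rw [two_mul, ENNReal.ofReal_add (Real.exp_pos _).le (Real.exp_pos _).le]
  refine (measure_mono fun ω hω => ?_).trans ((measure_union_le _ _).trans (add_le_add h₁ h₂))
  obtain ⟨hV, hZ⟩ := hω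
  rcases lt_abs.1 hZ with hZ | hZ
  · exact Or.inl ⟨hV, hZ⟩
  · exact Or.inr ⟨hV, by simpa [inner_neg_right] using hZ⟩

end Sample

/-! ### Nets of the range of a Lipschitz map -/

lemma LipschitzWith.exists_finset_net_range {k n : ℕ} {r ε : ℝ} {L : ℝ≥0}
    {G : latentBall k r → Vec n} (hG : LipschitzWith L G) (hr : 0 ≤ r) (hL : 0 < L) (hε : 0 < ε) :
    ∃ S : Finset (Vec n), (∀ w ∈ Set.range G, ∃ w' ∈ S, ‖w - w'‖ ≤ ε) ∧
      (S.card : ℝ) ≤ (1 + 2 * (L * r) / ε) ^ k := by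
  classical
  have hL' : (0 : ℝ) < L := hL
  obtain ⟨s, hs, hnet, hcard⟩ := exists_finset_net_closedBall (E := Vec k) hr (div_pos hε hL')
  refine ⟨s.attach.image fun c : {c // c ∈ s} => G ⟨c.1, hs c.1 c.2⟩, ?_, ?_⟩
  · rintro _ ⟨z, rfl⟩
    obtain ⟨c, hc, hzc⟩ := hnet z z.2
    refine ⟨_, Finset.mem_image_of_mem _ (Finset.mem_attach s ⟨c, hc⟩), ?_⟩
    rw [← dist_eq_norm]
    refine (hG.dist_le_mul _ _).trans ?_
    rw [Subtype.dist_eq]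
    exact (mul_le_mul_of_nonneg_left hzc hL'.le).trans_eq (by field_simp)
  · have h₁ : ((s.attach.image fun c : {c // c ∈ s} => G ⟨c.1, hs c.1 c.2⟩).card : ℝ) ≤ s.card := by
      exact_mod_cast Finset.card_image_le.trans_eq s.card_attach
    refine h₁.trans (hcard.trans_eq ?_)
    rw [finrank_euclideanSpace_fin]
    congr 2
    field_simp

/-! ### Deterministic error bound -/

lemma norm_le_sqrt_mul_of_forall_abs_le {n : ℕ} {w : Vec n} {t : ℝ} (ht : 0 ≤ t)
    (h : ∀ j, |w j| ≤ t) : ‖w‖ ≤ √n * t := by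
  rw [EuclideanSpace.norm_eq]
  refine Real.sqrt_le_iff.2 ⟨by positivity, ?_⟩
  calc ∑ j, ‖w j‖ ^ 2 ≤ ∑ _j : Fin n, t ^ 2 :=
        Finset.sum_le_sum fun j _ => pow_le_pow_left₀ (norm_nonneg _) (h j) 2
    _ = (√n * t) ^ 2 := by simp [mul_pow]

/-- The quadratic inequality satisfied by the error `‖w - q‖` of a projection `w` of `b`, compared
with a point `q` such that the deviation `b - q` is split along `x` and its complement. -/
lemma norm_sub_le_of_norm_sub_le {n : ℕ} (hn : 0 < n) {b x w h' : Vec n} {μ T c δ : ℝ}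
    (hx : ‖x‖ = 1) (hT : 0 ≤ T) (hc : 0 ≤ c) (hw : ‖w - b‖ ≤ ‖μ • x - b‖)
    (hpar : |inner ℝ b x - μ| ≤ T)
    (hnet : |inner ℝ (b - (inner ℝ b x : ℝ) • x) h'| ≤ 6 * T * ‖h'‖)
    (hcoord : ∀ j, |(b - (inner ℝ b x : ℝ) • x) j| ≤ 6 * T)
    (hclose : ‖w - μ • x - h'‖ ≤ δ / √n) (hδ : δ ≤ c * T) :
    ‖w - μ • x‖ ≤ (15 + 24 * c) * T := by
  set e : Vec n := b - (inner ℝ b x : ℝ) • x with he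
  set h : Vec n := w - μ • x with hh
  have hn' : (1 : ℝ) ≤ √n := Real.one_le_sqrt.2 (by exact_mod_cast hn)
  have hδ0 : 0 ≤ δ := by
    have := (norm_nonneg _).trans hclose
    by_contra! hneg
    exact absurd this (not_le.2 (div_neg_of_neg_of_pos hneg (by linarith)))
  -- Expand `‖h - (b - μ • x)‖ ^ 2 ≤ ‖b - μ • x‖ ^ 2`.
  have hbasic : ‖h‖ ^ 2 ≤ 2 * inner ℝ (b - μ • x) h := by
    have h₁ : ‖w - b‖ ^ 2 ≤ ‖μ • x - b‖ ^ 2 := pow_le_pow_left₀ (norm_nonneg _) hw 2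
    have h₂ : w - b = h - (b - μ • x) := by rw [hh]; abel
    rw [h₂, norm_sub_sq_real, norm_sub_rev (μ • x) b, real_inner_comm] at h₁
    linarith
  have hsplit : inner ℝ (b - μ • x) h
      = (inner ℝ b x - μ) * inner ℝ x h + inner ℝ e h' + inner ℝ e (h - h') := by
    have : b - μ • x = (inner ℝ b x - μ) • x + e := by rw [he, sub_smul]; abel
    rw [this, inner_add_left, real_inner_smul_left, add_assoc, ← inner_add_right]
    congr 2
    abel_nf
  have b₁ : (inner ℝ b x - μ) * inner ℝ x h ≤ T * ‖h‖ := by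
    refine (le_abs_self _).trans ?_
    rw [abs_mul]
    have := abs_real_inner_le_norm x h
    rw [hx, one_mul] at this
    exact mul_le_mul hpar this (abs_nonneg _) hT
  have b₂ : inner ℝ e h' ≤ 6 * T * (‖h‖ + δ) := by
    refine (le_abs_self _).trans (hnet.trans (mul_le_mul_of_nonneg_left ?_ (by positivity)))
    have h₁ : ‖h'‖ ≤ ‖h‖ + ‖h - h'‖ := norm_le_norm_add_norm_sub _ _
    have h₂ : δ / √n ≤ δ := div_le_self hδ0 hn'
    linarith
  have b₃ : inner ℝ e (h - h') ≤ 6 * T * δ := by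
    refine (real_inner_le_norm _ _).trans ?_
    refine (mul_le_mul (norm_le_sqrt_mul_of_forall_abs_le (by positivity) hcoord) hclose
      (norm_nonneg _) (by positivity)).trans_eq ?_
    field_simp
  by_contra! hlt
  have hTδ : T * δ ≤ c * T * T := by nlinarith
  have hhT : T ≤ ‖h‖ := by nlinarith [mul_nonneg hc hT]
  have hpos : 0 < ‖h‖ := lt_of_le_of_lt (by positivity) hlt
  nlinarith [mul_lt_mul_of_pos_right hlt hpos, mul_le_mul_of_nonneg_left hhT (mul_nonneg hc hT)]

lemma inner_backProj {Θ : Type*} {m n : ℕ} (f : Θ → ℝ → ℝ) (x v : Vec n) (a : Fin m → Vec n)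
    (s : Fin m → Θ) : inner ℝ (backProj (measMatrix a) (simObs f x a s)) v
      = (1 / (m : ℝ)) * ∑ i, f (s i) (inner ℝ (a i) x) * inner ℝ (a i) v := by
  have : backProj (measMatrix a) (simObs f x a s)
      = (1 / (m : ℝ)) • ∑ i, f (s i) (inner ℝ (a i) x) • a i := by
    ext j
    simp [backProj, measMatrix, simObs, Matrix.mulVec, dotProduct, mul_comm]
  rw [this, real_inner_smul_left, sum_inner]
  simp only [real_inner_smul_left]

/-- The projected deviation only sees the components of the measurement vectors orthogonal
to `x`. -/
lemma inner_sub_inner_smul {n : ℕ} (b x u : Vec n) :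
    inner ℝ (b - (inner ℝ b x : ℝ) • x) u = inner ℝ b (u - (inner ℝ x u : ℝ) • x) := by
  rw [inner_sub_left, inner_sub_right, real_inner_smul_left, real_inner_smul_right]
  ring

lemma norm_sub_inner_smul_le {n : ℕ} {x : Vec n} (hx : ‖x‖ = 1) (u : Vec n) :
    ‖u - (inner ℝ x u : ℝ) • x‖ ≤ ‖u‖ := by
  rw [← sq_le_sq₀ (norm_nonneg _) (norm_nonneg _), norm_sub_sq_real,
    real_inner_smul_right, norm_smul, hx, real_inner_comm, mul_one,
    Real.norm_eq_abs, sq_abs]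
  nlinarith [sq_nonneg (inner ℝ x u : ℝ)]

/-- The union bound over a net of resolution `δ / √n` and the `n` coordinate axes, where
`N = L * r / δ`: both cardinalities are at most `N ^ (3 * k) = exp (3 * ℓ)`. -/
lemma net_card_mul_exp_le {N ℓ : ℝ} {n k : ℕ} (hk : 0 < k) (hN : 3 ≤ N) (hn : (n : ℝ) ≤ N ^ 2)
    (hℓ : ℓ = k * Real.log N) :
    ((1 + 2 * N * √n) ^ k + n) * (2 * Real.exp (-(9 * ℓ))) ≤ Real.exp (-ℓ) := by
  have hN0 : 0 < N := by linarith
  have hX : Real.exp ℓ = N ^ k := by rw [hℓ, Real.exp_nat_mul, Real.exp_log hN0]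
  have hNX : N ≤ Real.exp ℓ := by
    rw [hX]; exact le_self_pow₀ (by linarith) hk.ne'
  set X := Real.exp ℓ with hXdef
  have hX3 : 3 ≤ X := hN.trans hNX
  have hsq : √(n : ℝ) ≤ N := Real.sqrt_le_iff.2 ⟨hN0.le, hn⟩
  have h₁ : (1 + 2 * N * √(n : ℝ)) ^ k ≤ X ^ 3 := by
    rw [hX, pow_right_comm]
    refine pow_le_pow_left₀ (by positivity) ?_ k
    have := mul_le_mul_of_nonneg_left hsq (by positivity : (0 : ℝ) ≤ 2 * N)
    nlinarith [mul_nonneg hN0.le hN0.le, mul_nonneg (mul_nonneg hN0.le hN0.le) (sub_nonneg.2 hN)]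
  have h₂ : (n : ℝ) ≤ X ^ 3 := by
    calc (n : ℝ) ≤ N ^ 2 := hn
      _ ≤ X ^ 2 := pow_le_pow_left₀ hN0.le hNX 2
      _ ≤ X ^ 3 := pow_le_pow_right₀ (by linarith) (by norm_num)
  have e₁ : Real.exp (-(9 * ℓ)) = (X ^ 9)⁻¹ := by
    rw [Real.exp_neg, hXdef, ← Real.exp_nat_mul]; norm_num
  rw [e₁, Real.exp_neg, ← hXdef]
  have hX0 : 0 < X := by linarith
  have h4 : (4 : ℝ) ≤ X ^ 5 := by
    calc (4 : ℝ) ≤ 3 ^ 5 := by norm_num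
      _ ≤ X ^ 5 := pow_le_pow_left₀ (by norm_num) hX3 5
  rw [inv_eq_one_div, inv_eq_one_div, ← mul_assoc, mul_one_div, div_le_div_iff₀ (by positivity) hX0]
  nlinarith [mul_le_mul_of_nonneg_left h4 (by positivity : (0 : ℝ) ≤ X ^ 4)]

/-! ### Moments of the random function -/

section Moments

variable {Θ : Type*} [MeasurableSpace Θ] {f : Θ → ℝ → ℝ} {ν : Measure Θ}

instance [IsProbabilityMeasure ν] : IsProbabilityMeasure (seedGaussian ν) :=
  inferInstanceAs (IsProbabilityMeasure (ν.prod (gaussianReal 0 1)))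

lemma FiniteFourthMoment.memLp_sq (hf : Measurable (Function.uncurry f))
    (h : FiniteFourthMoment f ν) : MemLp (fun p : Θ × ℝ => f p.1 p.2 ^ 2) 2 (seedGaussian ν) := by
  have hf' : Measurable fun p : Θ × ℝ => f p.1 p.2 := hf
  refine (memLp_two_iff_integrable_sq (by fun_prop)).2 ?_
  simp only [← pow_mul]
  exact h

lemma FiniteFourthMoment.memLp_mul_snd [IsProbabilityMeasure ν]
    (hf : Measurable (Function.uncurry f)) (h : FiniteFourthMoment f ν) :
    MemLp (fun p : Θ × ℝ => f p.1 p.2 * p.2) 2 (seedGaussian ν) := by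
  have hf' : Measurable fun p : Θ × ℝ => f p.1 p.2 := hf
  have hg : Integrable (fun p : Θ × ℝ => p.2 ^ 4) (seedGaussian ν) := by
    have h4 : Integrable (fun t : ℝ => t ^ 4) (gaussianReal 0 1) := by
      have hid : MemLp (id : ℝ → ℝ) ((4 : ℕ) : ENNReal) (gaussianReal 0 1) := by
        exact_mod_cast memLp_id_gaussianReal 4
      simpa [Even.pow_abs (by decide : Even 4)] using hid.integrable_norm_pow (by norm_num)
    exact h4.comp_snd ν
  refine (memLp_two_iff_integrable_sq (by fun_prop)).2 ?_
  refine (h.add hg).mono' (by fun_prop) (.of_forall fun p => ?_)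
  rw [Real.norm_eq_abs, abs_of_nonneg (by positivity), Pi.add_apply]
  nlinarith [sq_nonneg (f p.1 p.2 ^ 2 - p.2 ^ 2), sq_nonneg (f p.1 p.2 ^ 2 + p.2 ^ 2)]

lemma simXi_sq : simXi f ν ^ 2 = ∫ p, f p.1 p.2 ^ 2 ∂(seedGaussian ν) :=
  Real.sq_sqrt (integral_nonneg fun _ => sq_nonneg _)

end Moments

/-! ### The good event -/

/-- Up to a set of small outer measure, the component of `(1/m) Aᵀ y` along `x` is close to `μ` and
its components orthogonal to `x` are small in every direction of a finite set `U`. The first two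
failure terms come from Chebyshev's inequality for the empirical means of `f(g)²` and `f(g) g`. The
last one is a union bound, in which the bound `2 * m * ξ ^ 2` on `‖y‖²` turns the self-normalized
Gaussian tail into one with a deterministic variance. -/
lemma IsSIMSample.measure_not_forall_abs_inner_le {Ω Θ : Type*} [MeasurableSpace Ω]
    [MeasurableSpace Θ] {m n : ℕ}
    {P : Measure Ω} [IsProbabilityMeasure P] {ν : Measure Θ} [IsProbabilityMeasure ν]
    {a : Fin m → Ω → Vec n} {s : Fin m → Ω → Θ} (h : IsSIMSample P ν a s) (hm : 0 < m)
    {f : Θ → ℝ → ℝ} (hf : Measurable (Function.uncurry f)) (hf4 : FiniteFourthMoment f ν)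
    (hξ : 0 < simXi f ν) {x : Vec n} (hx : ‖x‖ = 1) {ℓ : ℝ} (hℓ : 0 < ℓ) (U : Finset (Vec n)) :
    P {ω | ¬ (|inner ℝ (backProj (measMatrix fun i => a i ω)
            (simObs f x (fun i => a i ω) fun i => s i ω)) x - simMu f ν| ≤ simXi f ν * √(ℓ / m) ∧
        ∀ u ∈ U, |inner ℝ (backProj (measMatrix fun i => a i ω)
            (simObs f x (fun i => a i ω) fun i => s i ω)) (u - (inner ℝ x u : ℝ) • x)|
          ≤ 6 * (simXi f ν * √(ℓ / m)) * ‖u‖)}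
      ≤ ENNReal.ofReal (simThetaFourth f ν / (m * simXi f ν ^ 4)
          + simRhoSq f ν / (simXi f ν ^ 2 * ℓ) + U.card * (2 * Real.exp (-(9 * ℓ)))) := by
  have hm' : (0 : ℝ) < m := by exact_mod_cast hm
  set ξ := simXi f ν with hξdef
  set T := ξ * √(ℓ / m) with hTdef
  have hT : 0 < T := mul_pos hξ (Real.sqrt_pos.2 (by positivity))
  have hT2 : m * T ^ 2 = ξ ^ 2 * ℓ := by
    rw [hTdef, mul_pow, Real.sq_sqrt (by positivity)]; field_simp
  have hf' : Measurable fun p : Θ × ℝ => f p.1 p.2 := hf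
  have h₁ := h.measure_abs_mean_sub_ge_le hm hx (φ := fun p => f p.1 p.2 ^ 2) (by fun_prop)
    (hf4.memLp_sq hf) (t := ξ ^ 2) (by positivity)
  have h₂ := h.measure_abs_mean_sub_ge_le hm hx (φ := fun p => f p.1 p.2 * p.2) (by fun_prop)
    (hf4.memLp_mul_snd hf) hT
  have hB : 0 < 2 * m * ξ ^ 2 := by positivity
  have h₃ : ∀ u : Vec n, P {ω | ∑ i, f (s i ω) (inner ℝ (a i ω) x) ^ 2 ≤ 2 * m * ξ ^ 2 ∧
      6 * (m * T) * ‖u - (inner ℝ x u : ℝ) • x‖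
        < |∑ i, f (s i ω) (inner ℝ (a i ω) x) * inner ℝ (a i ω) (u - (inner ℝ x u : ℝ) • x)|}
      ≤ ENNReal.ofReal (2 * Real.exp (-(9 * ℓ))) := by
    intro u
    have hxu : inner ℝ x (u - (inner ℝ x u : ℝ) • x) = 0 := by
      rw [inner_sub_right, real_inner_smul_right, real_inner_self_eq_norm_sq, hx]; ring
    refine (h.measure_abs_sum_mul_inner_gt_le hf hxu hB (by positivity)).trans_eq ?_
    rw [show (6 * (m * T)) ^ 2 / (2 * (2 * m * ξ ^ 2)) = 9 * ℓ by
      rw [show (6 * (m * T)) ^ 2 = 36 * m * (m * T ^ 2) by ring, hT2]; field_simp; norm_num]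
  rw [← simXi_sq, ← hξdef, ← pow_mul] at h₁
  rw [hT2] at h₂
  have hθ : 0 ≤ simThetaFourth f ν / (m * ξ ^ 4) :=
    div_nonneg (variance_nonneg _ _) (by positivity)
  have hρ : 0 ≤ simRhoSq f ν / (ξ ^ 2 * ℓ) := div_nonneg (variance_nonneg _ _) (by positivity)
  rw [ENNReal.ofReal_add (by positivity) (by positivity), ENNReal.ofReal_add hθ hρ,
    ENNReal.ofReal_mul (by positivity), ENNReal.ofReal_natCast]
  have hU := (measure_biUnion_finset_le (μ := P) U _).trans
    (Finset.sum_le_card_nsmul U _ _ fun u _ => h₃ u)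
  rw [nsmul_eq_mul] at hU
  refine (measure_mono fun ω hω => ?_).trans ((measure_union_le _ _).trans
    (add_le_add ((measure_union_le _ _).trans (add_le_add h₁ h₂)) hU))
  by_contra hout
  simp only [Set.mem_union, Set.mem_ofPred_eq, Set.mem_iUnion, not_or, not_exists, not_and,
    not_le, not_lt] at hout
  obtain ⟨⟨o₁, o₂⟩, o₃⟩ := hout
  refine hω ⟨?_, fun u hu => ?_⟩
  · rw [inner_backProj]
    exact o₂.le
  · have hV : ∑ i, f (s i ω) (inner ℝ (a i ω) x) ^ 2 ≤ 2 * m * ξ ^ 2 := by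
      have := (abs_lt.1 o₁).2
      rw [sub_lt_iff_lt_add, one_div, inv_mul_lt_iff₀ hm'] at this
      linarith
    rw [inner_backProj, abs_mul, abs_of_pos (by positivity), one_div, inv_mul_le_iff₀ hm']
    refine (o₃ u hu hV).trans ?_
    rw [show m * (6 * T * ‖u‖) = 6 * (m * T) * ‖u‖ by ring]
    exact mul_le_mul_of_nonneg_left (norm_sub_inner_smul_le hx u) (by positivity)

/-- The estimator need not be measurable, so bad events are controlled in outer measure only; a
measurable hull turns such a bound into a measurable good event. -/
lemma exists_measurableSet_subset_of_measure_compl_le {Ω : Type*} [MeasurableSpace Ω]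
    {P : Measure Ω} [IsProbabilityMeasure P] {A : Set Ω} {t : ℝ} (ht : 0 ≤ t)
    (h : P Aᶜ ≤ ENNReal.ofReal t) :
    ∃ E ⊆ A, MeasurableSet E ∧ 1 - t ≤ P.real E := by
  refine ⟨(toMeasurable P Aᶜ)ᶜ, Set.compl_subset_comm.1 (subset_toMeasurable P Aᶜ),
    (measurableSet_toMeasurable P _).compl, ?_⟩
  rw [probReal_compl_eq_one_sub (measurableSet_toMeasurable P _), measureReal_def,
    measure_toMeasurable]
  linarith [ENNReal.toReal_le_of_le_ofReal ht h]

/-! ### Recovery from the projected linear estimator -/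

theorem theorem1 (c₁ c₂ : ℝ) (hc₁ : 0 < c₁) (hc₂ : 0 < c₂) :
    ∃ c C : ℝ, 0 < c ∧ 0 < C ∧
      ∀ (m n k : ℕ), 0 < m → 0 < n → 0 < k →
      -- the single index model
      ∀ (Ω Θ : Type*) [MeasurableSpace Ω] [MeasurableSpace Θ]
        (P : Measure Ω) [IsProbabilityMeasure P] (ν : Measure Θ) [IsProbabilityMeasure ν]
        (f : Θ → ℝ → ℝ), Measurable (Function.uncurry f) →
        FiniteFourthMoment f ν → simMu f ν ≠ 0 →
      ∀ (a : Fin m → Ω → Vec n) (s : Fin m → Ω → Θ), IsSIMSample P ν a s →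
      -- the generative model
      ∀ (r : ℝ) (L : ℝ≥0) (G : latentBall k r → Vec n), 0 < r → LipschitzWith L G →
      -- the signal and the estimator
      ∀ x : Vec n, ‖x‖ = 1 → simMu f ν • x ∈ Set.range G →
      ∀ xhat : Ω → Vec n,
        (∀ ω, IsProjOn (Set.range G)
          (backProj (measMatrix fun i => a i ω) (simObs f x (fun i => a i ω) (fun i => s i ω)))
          (xhat ω)) →
      -- the accuracy parameter
      ∀ δ : ℝ, 0 < δ → c₁ * (δ * n) ≤ L * r →
        δ ≤ c₂ * (simXi f ν * Real.sqrt (k * Real.log (L * r / δ) / m)) →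
      ∃ E : Set Ω, MeasurableSet E ∧
        1 - Real.exp (-(c * (k * Real.log (L * r / δ))))
            - simThetaFourth f ν / (m * simXi f ν ^ 4)
            - simRhoSq f ν / (simXi f ν ^ 2 * (k * Real.log (L * r / δ))) ≤ P.real E ∧
        ∀ ω ∈ E, ‖xhat ω - simMu f ν • x‖
          ≤ C * (simXi f ν * Real.sqrt (k * Real.log (L * r / δ) / m)) := by
  classical
  -- `3 ≤ N` absorbs numerical factors into powers of `N = L * r / δ`, and `1 / c₁ ≤ N` turns
  -- `c₁ * n ≤ N` into `n ≤ N ^ 2`; below the threshold `K` the claim is about the diameter of the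
  -- range only.
  set K : ℝ := max 3 (1 / c₁) with hKdef
  have hK : 0 < K := lt_of_lt_of_le (by norm_num) (le_max_left _ _)
  refine ⟨1, 15 + 24 * c₂ + 2 * K * c₂, one_pos, by positivity, ?_⟩
  intro m n k hm hn hk Ω Θ _ _ P _ ν _ f hf hf4 _ a s hs r L G hr hG x hx hxG xhat hproj
    δ hδ hδ₁ hδ₂
  have hm' : (0 : ℝ) < m := by exact_mod_cast hm
  have hn' : (0 : ℝ) < n := by exact_mod_cast hn
  have hk' : (0 : ℝ) < k := by exact_mod_cast hk
  have hLr : 0 < L * r := lt_of_lt_of_le (by positivity) hδ₁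
  have hL : 0 < L := by
    have : (0 : ℝ) < L := pos_of_mul_pos_left hLr hr.le
    exact_mod_cast this
  set N : ℝ := L * r / δ with hNdef
  have hN0 : 0 < N := div_pos hLr hδ
  have hNδ : N * δ = L * r := div_mul_cancel₀ _ hδ.ne'
  set ℓ : ℝ := k * Real.log N with hℓdef
  set T : ℝ := simXi f ν * √(ℓ / m) with hTdef
  have hT : 0 < T := (pos_iff_pos_of_mul_pos (hδ.trans_le hδ₂)).1 hc₂
  have hξ : 0 < simXi f ν := by
    refine (Real.sqrt_nonneg _).lt_of_ne' fun h0 => ?_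
    rw [hTdef, show simXi f ν = 0 from h0, zero_mul] at hT
    exact lt_irrefl _ hT
  have hℓ : 0 < ℓ := by
    have : 0 < ℓ / m := Real.sqrt_pos.1 ((pos_iff_pos_of_mul_pos hT).1 hξ)
    exact (div_pos_iff_of_pos_right hm').1 this
  have hθ : 0 ≤ simThetaFourth f ν / (m * simXi f ν ^ 4) :=
    div_nonneg (variance_nonneg _ _) (by positivity)
  have hρ : 0 ≤ simRhoSq f ν / (simXi f ν ^ 2 * ℓ) :=
    div_nonneg (variance_nonneg _ _) (by positivity)
  rw [one_mul]
  rcases lt_or_ge N K with hNK | hNK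
  · -- The diameter of the range of `G` is at most `2 * L * r ≤ 2 * K * δ`.
    refine ⟨Set.univ, MeasurableSet.univ, ?_, fun ω _ => ?_⟩
    · rw [probReal_univ]
      linarith [Real.exp_pos (-ℓ)]
    · obtain ⟨z, hz⟩ := (hproj ω).1
      obtain ⟨z', hz'⟩ := hxG
      rw [← hz, ← hz', ← dist_eq_norm]
      have hd : dist z z' ≤ 2 * r := by
        have h₁ := Metric.mem_closedBall.1 z.2
        have h₂ := Metric.mem_closedBall.1 z'.2
        rw [Subtype.dist_eq]
        linarith [dist_triangle_right (z : Vec k) z' 0]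
      have h₁ : dist (G z) (G z') ≤ L * (2 * r) :=
        (hG.dist_le_mul z z').trans (mul_le_mul_of_nonneg_left hd L.coe_nonneg)
      have h₂ : N * δ ≤ K * (c₂ * T) := mul_le_mul hNK.le hδ₂ hδ.le hK.le
      have h₃ : 0 ≤ (15 + 24 * c₂) * T := by positivity
      linarith
  · have hN3 : 3 ≤ N := (le_max_left _ _).trans hNK
    have hnN : (n : ℝ) ≤ N ^ 2 := by
      have h₁ : c₁ * n ≤ N := by
        rw [hNdef, le_div_iff₀ hδ]; linarith
      have h₂ : 1 ≤ c₁ * N := by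
        have := (le_max_right 3 (1 / c₁)).trans hNK
        rwa [div_le_iff₀' hc₁] at this
      nlinarith
    -- The resolution `δ / √n` compensates the factor `√n` in the norm of a Gaussian vector, and
    -- `n ≤ N ^ 2` keeps the logarithm of the size of this finer net of order `k * log N`.
    have hε : 0 < δ / √(n : ℝ) := div_pos hδ (Real.sqrt_pos.2 hn')
    obtain ⟨S, hnet, hcard⟩ := hG.exists_finset_net_range hr.le hL hε
    -- Directions to be controlled: the net, seen from the signal, and the coordinate axes, which
    -- control the norm of the Gaussian part of the deviation.
    let U : Finset (Vec n) := S.image (fun w => w - simMu f ν • x) ∪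
      Finset.univ.image fun j => EuclideanSpace.single j (1 : ℝ)
    have hUcard : (U.card : ℝ) ≤ (1 + 2 * N * √n) ^ k + n := by
      have h₁ : U.card ≤ S.card + n :=
        (Finset.card_union_le _ _).trans (add_le_add Finset.card_image_le
          (Finset.card_image_le.trans_eq (by simp)))
      have h₂ : (1 + 2 * (L * r) / (δ / √(n : ℝ))) = 1 + 2 * N * √n := by
        rw [hNdef]; field_simp
      rw [h₂] at hcard
      calc (U.card : ℝ) ≤ S.card + n := by exact_mod_cast h₁
        _ ≤ _ := by gcongr
    have hbad := (hs.measure_not_forall_abs_inner_le hm hf hf4 hξ hx hℓ U).trans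
      (ENNReal.ofReal_le_ofReal (add_le_add le_rfl ((mul_le_mul_of_nonneg_right hUcard (by positivity)).trans
        (net_card_mul_exp_le hk hN3 hnN hℓdef))))
    obtain ⟨E, hEsub, hEm, hE⟩ := exists_measurableSet_subset_of_measure_compl_le
      (by positivity) hbad
    refine ⟨E, hEm, by linarith, fun ω hω => ?_⟩
    obtain ⟨hpar, hU⟩ := hEsub hω
    obtain ⟨w', hw', hclose⟩ := hnet (xhat ω) (hproj ω).1
    have hmain : ‖xhat ω - simMu f ν • x‖ ≤ (15 + 24 * c₂) * T := by
      refine norm_sub_le_of_norm_sub_le hn hx hT.le hc₂.le ((hproj ω).2 _ hxG) hpar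
        (h' := w' - simMu f ν • x) ?_ (fun j => ?_) (by rwa [sub_sub_sub_cancel_right]) hδ₂
      · rw [inner_sub_inner_smul]
        exact hU _ (Finset.mem_union_left _ (Finset.mem_image_of_mem _ hw'))
      · have := hU _ (Finset.mem_union_right _ (Finset.mem_image_of_mem _ (Finset.mem_univ j)))
        rw [← inner_sub_inner_smul, ← hTdef] at this
        simpa [EuclideanSpace.inner_single_right] using this
    have : 0 ≤ 2 * K * c₂ * T := by positivity
    linarith
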